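/- Let $\Gamma_0$ be a triangle (three vertices, pairwise adjacent), and for $n\ge 0$ let $\Gamma_{n+1}$ be the graph obtained by partitioning an equilateral triangle into four smaller equilateral triangles and putting a copy of $\Gamma_n$ in each of the three corner triangles, so that any two of the copies share exactly one of their outmost vertices; the three corners of the large triangle are the outmost vertices of $\Gamma_{n+1}$. (Thus $\Gamma_1$ has $6$ vertices and $9$ edges.) A spanning $k$-forest of a graph is a spanning subgraph without cycles that has exactly $k$ connected components. Let $\tau(\Gamma_n)$ be the number of spanning trees of $\Gamma_n$; let $s(\Gamma_n)$ be the number of spanning $2$-forests of $\Gamma_n$ in which two fixed outmost vertices belong to the same connected component and the third outmost vertex belongs to the other component; and let $q(\Gamma_n)$ be the number of spanning $3$-forests of $\Gamma_n$ in which the three outmost vertices belong to three different connected components. Then for every $n\ge 1$, and for each choice of the two fixed outmost vertices in the definition of $s(\Gamma_n)$, $$\tau(\Gamma_n)=2^{\frac{3^n-1}{2}}\,3^{\frac{3^{n+1}+2n+1}{4}}\,5^{\frac{3^n-2n-1}{4}},$$ $$s(\Gamma_n)=2^{\frac{3^n-1}{2}}\,3^{\frac{3^{n+1}-2n-3}{4}}\,5^{\frac{3^n+2n-1}{4}},$$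 $$q(\Gamma_n)=2^{\frac{3^n-1}{2}}\,3^{\frac{3^{n+1}-6n-3}{4}}\,5^{\frac{3^n+6n-1}{4}}.$$ Moreover, the asymptotic growth constant of the spanning trees of $\Gamma_n$ is $$\lim_{n\to\infty}\frac{\log\tau(\Gamma_n)}{|V(\Gamma_n)|}=\frac13\log 2+\frac12\log 3+\frac16\log 5.$$ -/

import Mathlib

open Filter Topology

/-- Translation of the lattice `ℕ × ℕ` by the vector `v`. -/
def latticeShift (v : ℕ × ℕ) : (ℕ × ℕ) ↪ (ℕ × ℕ) := addRightEmbedding v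

/-- The vertices of the Sierpiński graph of level `n`, drawn in the triangular lattice: the point
`(x, y)` stands for `x • u + y • w`, where `u, w` are two unit vectors at angle `π / 3`.
The outer triangle of level `n` has the corners `(0, 0)`, `(2 ^ n, 0)`, `(0, 2 ^ n)`; level `n + 1`
consists of three copies of level `n`, one in each corner of the triangle of side `2 ^ (n + 1)`. -/
def sierpinskiVertices : ℕ → Finset (ℕ × ℕ)
  | 0 => {(0, 0), (1, 0), (0, 1)}
  | n + 1 => sierpinskiVertices n ∪ (sierpinskiVertices n).map (latticeShift (2 ^ n, 0)) ∪
      (sierpinskiVertices n).map (latticeShift (0, 2 ^ n))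

/-- The edges of the Sierpiński graph of level `n`, as a graph on all lattice points.
Level `0` is a single triangle; hence level `1` is the graph with 6 vertices and 9 edges made of
three triangles which pairwise share a vertex. -/
def sierpinskiLattice : ℕ → SimpleGraph (ℕ × ℕ)
  | 0 => SimpleGraph.fromEdgeSet
      {s((0, 0), (1, 0)), s((1, 0), (0, 1)), s((0, 1), (0, 0))}
  | n + 1 => sierpinskiLattice n ⊔ (sierpinskiLattice n).map (latticeShift (2 ^ n, 0)) ⊔
      (sierpinskiLattice n).map (latticeShift (0, 2 ^ n))

/-- The Sierpiński graph `Γ_n`. -/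
def sierpinskiGraph (n : ℕ) : SimpleGraph {p : ℕ × ℕ // p ∈ sierpinskiVertices n} :=
  (sierpinskiLattice n).comap Subtype.val

/-- The coordinates of the three outmost vertices of `Γ_n`. -/
def sierpinskiCornerPoint (n : ℕ) : Fin 3 → ℕ × ℕ :=
  ![(0, 0), (2 ^ n, 0), (0, 2 ^ n)]

theorem sierpinskiCornerPoint_mem (n : ℕ) (i : Fin 3) :
    sierpinskiCornerPoint n i ∈ sierpinskiVertices n := by
  induction n generalizing i with
  | zero => fin_cases i <;> simp [sierpinskiCornerPoint, sierpinskiVertices]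
  | succ n ih =>
    have h0 := ih 0
    have h1 := ih 1
    have h2 := ih 2
    simp only [sierpinskiCornerPoint, Matrix.cons_val] at h0 h1 h2
    fin_cases i
    · simp [sierpinskiCornerPoint, sierpinskiVertices, h0]
    · simp only [sierpinskiCornerPoint, sierpinskiVertices, Finset.mem_union, Finset.mem_map]
      exact Or.inl (Or.inr ⟨_, h1, by simp [latticeShift, pow_succ, mul_two]⟩)
    · simp only [sierpinskiCornerPoint, sierpinskiVertices, Finset.mem_union, Finset.mem_map]
      exact Or.inr ⟨_, h2, by simp [latticeShift, pow_succ, mul_two]⟩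

/-- The three outmost vertices of `Γ_n`. -/
def sierpinskiCorner (n : ℕ) (i : Fin 3) : {p : ℕ × ℕ // p ∈ sierpinskiVertices n} :=
  ⟨sierpinskiCornerPoint n i, sierpinskiCornerPoint_mem n i⟩

/-- The complexity `τ(G)`: the number of spanning trees of `G`, that is, of trees `H` on the full
vertex set of `G` all of whose edges are edges of `G`. -/
noncomputable def numSpanningTrees {V : Type*} (G : SimpleGraph V) : ℕ :=
  {H : SimpleGraph V | H ≤ G ∧ H.IsTree}.ncard

/-- `H` is a spanning `k`-forest of `G`: a spanning subgraph without cycles, with exactly `k`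
connected components. -/
def IsSpanningForest {V : Type*} (G : SimpleGraph V) (k : ℕ) (H : SimpleGraph V) : Prop :=
  H ≤ G ∧ H.IsAcyclic ∧ ENat.card H.ConnectedComponent = k

/-- The number `s(Γ_n)` of spanning `2`-forests of `Γ_n` in which the outmost vertices numbered
`i` and `j` lie in the same component and the outmost vertex numbered `k` lies in the other one. -/
noncomputable def sierpinskiTwoForests (n : ℕ) (i j k : Fin 3) : ℕ :=
  {H | IsSpanningForest (sierpinskiGraph n) 2 H ∧
    H.Reachable (sierpinskiCorner n i) (sierpinskiCorner n j) ∧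
    ¬ H.Reachable (sierpinskiCorner n i) (sierpinskiCorner n k)}.ncard

/-- The number `q(Γ_n)` of spanning `3`-forests of `Γ_n` in which the three outmost vertices lie in
three different components. -/
noncomputable def sierpinskiThreeForests (n : ℕ) : ℕ :=
  {H | IsSpanningForest (sierpinskiGraph n) 3 H ∧
    ∀ i j : Fin 3, i ≠ j →
      ¬ H.Reachable (sierpinskiCorner n i) (sierpinskiCorner n j)}.ncard

/-!
A spanning forest of `Γ_{n + 1}` is a union of one forest on each of the three copies of `Γ_n`.
Whether such a union is again a forest in which every component contains an outmost vertex, and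
which outmost vertices it connects, depends only on the partitions which the three forests induce
on the corners of the copies: by Euler's formula the union has no cycle if and only if the number
of classes drops by exactly `3`, once for each pair of identified corners. Counting the admissible
triples of partitions gives, for the numbers `τ`, `s`, `q` of level `n`,

* `τ' = 6 τ² s`,
* `s' = 7 τ s² + τ² q`,
* `q' = 14 s³ + 12 τ s q`.

The relation `τ q = 3 s²` is invariant and turns the last two recursions into `s' = 10 τ s²` and
`q' = 50 s³`, so that all three numbers are products of powers of `2`, `3` and `5`.
-/

section MergeLabels

variable {α β : Type*} [DecidableEq β]

/-- One step of a union-find computation on a labelling `l`: the class of `b` is given the label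
of `a`. -/
def mergeLabels (l : α → β) (a b x : α) : β :=
  if l x = l b then l a else l x

theorem ker_mergeLabels_le_iff {l : α → β} {a b : α} {s : Setoid α} :
    Setoid.ker (mergeLabels l a b) ≤ s ↔ Setoid.ker l ≤ s ∧ s a b := by
  simp only [Setoid.le_def, Setoid.ker_def, mergeLabels]
  refine ⟨fun h => ⟨fun hxy => h (by rw [hxy]), h (by simp)⟩, fun ⟨hl, hab⟩ x y hxy => ?_⟩
  split_ifs at hxy with hx hy hy
  · exact hl (hx.trans hy.symm)
  · exact s.trans' (hl hx) (s.trans' (s.symm' hab) (hl hxy))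
  · exact s.trans' (hl hxy) (s.trans' hab (s.symm' (hl hy)))
  · exact hl hxy

theorem range_mergeLabels {l : α → β} (hl : Function.Surjective l) {a b : α} (h : l a ≠ l b) :
    Set.range (mergeLabels l a b) = {l b}ᶜ := by
  ext y
  constructor
  · rintro ⟨x, rfl⟩
    by_cases hx : l x = l b <;> simp [mergeLabels, hx, h]
  · intro hy
    obtain ⟨x, rfl⟩ := hl y
    exact ⟨x, if_neg hy⟩

end MergeLabels

section Forest

open SimpleGraph

variable {V : Type*} {G : SimpleGraph V} {u v : V}

theorem reachableSetoid_le_iff {s : Setoid V} :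
    G.reachableSetoid ≤ s ↔ ∀ ⦃x y⦄, G.Adj x y → s x y := by
  refine ⟨fun h x y hxy => h hxy.reachable, fun h x y hxy => ?_⟩
  obtain ⟨p⟩ := hxy
  induction p with
  | nil => exact s.refl' _
  | cons hadj _ ih => exact s.trans' (h hadj) ih

theorem reachableSetoid_sup_edge [DecidableEq G.ConnectedComponent] :
    (G ⊔ edge u v).reachableSetoid = Setoid.ker (mergeLabels G.connectedComponentMk u v) := by
  have hker : Setoid.ker G.connectedComponentMk = G.reachableSetoid := by
    ext x y
    exact ConnectedComponent.eq
  refine eq_of_forall_ge_iff fun s => ?_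
  rw [ker_mergeLabels_le_iff, hker, reachableSetoid_le_iff, reachableSetoid_le_iff]
  simp only [sup_adj, edge_adj]
  refine ⟨fun h => ⟨fun x y hxy => h (.inl hxy), ?_⟩, ?_⟩
  · rcases eq_or_ne u v with rfl | huv
    exacts [s.refl' u, h (.inr ⟨.inl ⟨rfl, rfl⟩, huv⟩)]
  · rintro ⟨hG, huv⟩ x y (hxy | ⟨⟨rfl, rfl⟩ | ⟨rfl, rfl⟩, -⟩)
    exacts [hG hxy, huv, s.symm' huv]

theorem card_connectedComponent_sup_edge_of_reachable (h : G.Reachable u v) :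
    Nat.card (G ⊔ edge u v).ConnectedComponent = Nat.card G.ConnectedComponent := by
  classical
  have hmerge : mergeLabels G.connectedComponentMk u v = G.connectedComponentMk := by
    funext x
    rw [mergeLabels, ConnectedComponent.sound h, ite_eq_right_iff]
    exact Eq.symm
  change Nat.card (Quotient (G ⊔ edge u v).reachableSetoid) = _
  rw [reachableSetoid_sup_edge, hmerge]
  exact Nat.card_congr (Setoid.quotientKerEquivOfSurjective _ Quot.mk_surjective)

theorem card_connectedComponent_sup_edge_of_not_reachable [Finite V] (h : ¬ G.Reachable u v) :
    Nat.card (G ⊔ edge u v).ConnectedComponent + 1 = Nat.card G.ConnectedComponent := by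
  classical
  have hne : G.connectedComponentMk u ≠ G.connectedComponentMk v := mt ConnectedComponent.exact h
  change Nat.card (Quotient (G ⊔ edge u v).reachableSetoid) + 1 = _
  rw [reachableSetoid_sup_edge, Nat.card_congr (Setoid.quotientKerEquivRange _),
    range_mergeLabels (l := G.connectedComponentMk) Quot.mk_surjective hne, Nat.card_coe_set_eq,
    add_comm, ← Set.ncard_singleton (G.connectedComponentMk v), Set.ncard_add_ncard_compl]

theorem ncard_edgeSet_sup_edge [Finite V] (huv : u ≠ v) (h : ¬ G.Adj u v) :
    (G ⊔ edge u v).edgeSet.ncard = G.edgeSet.ncard + 1 := by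
  rw [edgeSet_sup, edgeSet_edge_of_ne huv, Set.union_singleton,
    Set.ncard_insert_of_notMem (by simpa using h) (Set.toFinite _)]

theorem sup_edge_induction [Finite V] {motive : SimpleGraph V → Prop} (bot : motive ⊥)
    (sup_edge : ∀ G u v, u ≠ v → ¬ G.Adj u v → motive G → motive (G ⊔ edge u v))
    (G : SimpleGraph V) : motive G := by
  rw [← fromEdgeSet_edgeSet G]
  induction G.edgeSet, Set.toFinite G.edgeSet using Set.Finite.induction_on with
  | empty => rwa [fromEdgeSet_empty]
  | @insert e s he _ ih =>
    induction e using Sym2.ind with | _ u v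
    rw [Set.insert_eq, Set.union_comm, fromEdgeSet_union]
    rcases eq_or_ne u v with rfl | huv
    · simpa using ih
    · exact sup_edge _ u v huv (fun h => he h.1) ih

theorem card_connectedComponent_bot :
    Nat.card (⊥ : SimpleGraph V).ConnectedComponent = Nat.card V :=
  (Nat.card_congr (Equiv.ofBijective (connectedComponentMk _)
    ⟨fun x y hxy => by simpa using hxy, Quot.mk_surjective⟩)).symm

theorem card_le_ncard_edgeSet_add_card_connectedComponent [Finite V] (G : SimpleGraph V) :
    Nat.card V ≤ G.edgeSet.ncard + Nat.card G.ConnectedComponent := by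
  induction G using sup_edge_induction with
  | bot => simp [card_connectedComponent_bot]
  | sup_edge F u v huv hadj ih =>
    have hE := ncard_edgeSet_sup_edge huv hadj
    by_cases h : F.Reachable u v
    · have := card_connectedComponent_sup_edge_of_reachable h
      omega
    · have := card_connectedComponent_sup_edge_of_not_reachable h
      omega

theorem isAcyclic_iff_ncard_edgeSet_add_card_connectedComponent [Finite V] (G : SimpleGraph V) :
    G.IsAcyclic ↔ G.edgeSet.ncard + Nat.card G.ConnectedComponent = Nat.card V := by
  induction G using sup_edge_induction with
  | bot => simp [card_connectedComponent_bot]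
  | sup_edge F u v huv hadj ih =>
    have hE := ncard_edgeSet_sup_edge huv hadj
    have hacyclic : (F ⊔ edge u v).IsAcyclic ↔ F.IsAcyclic ∧ ¬ F.Reachable u v := by
      rw [isAcyclic_sup_fromEdgeSet_iff]
      simp [huv, hadj]
    rw [hacyclic, ih]
    by_cases h : F.Reachable u v
    · have hC := card_connectedComponent_sup_edge_of_reachable h
      have := card_le_ncard_edgeSet_add_card_connectedComponent F
      simp only [h, not_true_eq_false, and_false, false_iff]
      omega
    · have hC := card_connectedComponent_sup_edge_of_not_reachable h
      simp only [h, not_false_eq_true, and_true]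
      omega

end Forest

section TerminalForest

open SimpleGraph

variable {ι V W : Type*} {b : ι → V} {r : Setoid ι} {G H : SimpleGraph V}

/-- The partition which the connected components of `H` induce on the terminals `b`. -/
def terminalPartition (b : ι → V) (H : SimpleGraph V) : Setoid ι :=
  H.reachableSetoid.comap b

/-- `H` is a forest in which every component contains one of the terminals `b`. -/
structure IsTerminalForest (b : ι → V) (H : SimpleGraph V) : Prop where
  isAcyclic : H.IsAcyclic
  exists_reachable : ∀ v, ∃ i, H.Reachable (b i) v

theorem card_quotient_terminalPartition :
    Nat.card (Quotient (terminalPartition b H)) =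
      (Set.range fun i => H.connectedComponentMk (b i)).ncard := by
  rw [← Nat.card_coe_set_eq]
  exact Nat.card_congr (H.reachableSetoid.comapQuotientEquiv b)

theorem range_connectedComponentMk_eq_univ_iff :
    (Set.range fun i => H.connectedComponentMk (b i)) = Set.univ ↔
      ∀ v, ∃ i, H.Reachable (b i) v := by
  simp only [Set.eq_univ_iff_forall, Set.mem_range, ConnectedComponent.forall,
    ConnectedComponent.eq]

theorem card_connectedComponent_eq_card_quotient_iff [Finite V] :
    Nat.card H.ConnectedComponent = Nat.card (Quotient (terminalPartition b H)) ↔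
      ∀ v, ∃ i, H.Reachable (b i) v := by
  rw [card_quotient_terminalPartition, ← range_connectedComponentMk_eq_univ_iff,
    Set.eq_univ_iff_ncard, eq_comm]

theorem isTerminalForest_iff_ncard_edgeSet [Finite V] (h : ∀ v, ∃ i, H.Reachable (b i) v) :
    IsTerminalForest b H ↔
      H.edgeSet.ncard + Nat.card (Quotient (terminalPartition b H)) = Nat.card V := by
  rw [← card_connectedComponent_eq_card_quotient_iff.2 h,
    ← isAcyclic_iff_ncard_edgeSet_add_card_connectedComponent]
  exact ⟨fun hH => hH.isAcyclic, fun hH => ⟨hH, h⟩⟩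

theorem isSpanningForest_card_quotient_iff [Finite V] :
    IsSpanningForest G (Nat.card (Quotient (terminalPartition b H))) H ↔
      H ≤ G ∧ IsTerminalForest b H := by
  rw [IsSpanningForest, ENat.card_eq_coe_natCard, Nat.cast_inj,
    card_connectedComponent_eq_card_quotient_iff]
  exact and_congr_right fun _ => ⟨fun h => ⟨h.1, h.2⟩, fun h => ⟨h.1, h.2⟩⟩

/-- The spanning forests of `G` in which every component contains a terminal and which induce the
partition `r` on the terminals. -/
def terminalForests (b : ι → V) (G : SimpleGraph V) (r : Setoid ι) : Set (SimpleGraph V) :=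
  {H | H ≤ G ∧ IsTerminalForest b H ∧ terminalPartition b H = r}

theorem isTree_iff_isTerminalForest [Nonempty ι] :
    H.IsTree ↔ IsTerminalForest b H ∧ terminalPartition b H = ⊤ := by
  have hι := ‹Nonempty ι›.some
  rw [Setoid.eq_top_iff]
  refine ⟨fun h => ⟨⟨h.isAcyclic, fun v => ⟨hι, h.connected.preconnected _ _⟩⟩,
    fun i j => h.connected.preconnected _ _⟩, fun ⟨h, htop⟩ => ⟨?_, h.isAcyclic⟩⟩
  refine (connected_iff_exists_forall_reachable H).2 ⟨b hι, fun v => ?_⟩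
  obtain ⟨i, hi⟩ := h.exists_reachable v
  exact (htop hι i).trans hi

theorem numSpanningTrees_eq_ncard_terminalForests [Nonempty ι] (b : ι → V) (G : SimpleGraph V) :
    numSpanningTrees G = (terminalForests b G ⊤).ncard := by
  simp only [numSpanningTrees, terminalForests, isTree_iff_isTerminalForest (b := b)]

theorem comap_mem_terminalForests_iff (e : V ≃ W) {G H : SimpleGraph W} :
    H.comap e ∈ terminalForests b (G.comap e) r ↔ H ∈ terminalForests (e ∘ b) G r := by
  let φ : H.comap e ≃g H := Iso.comap e H
  have hle : H.comap e ≤ G.comap e ↔ H ≤ G := by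
    refine ⟨fun h v w hadj => ?_, fun h _ _ hadj => h hadj⟩
    simpa using @h (e.symm v) (e.symm w) (by simpa)
  have hpartition : terminalPartition b (H.comap e) = terminalPartition (e ∘ b) H :=
    Setoid.ext fun i j => φ.reachable_iff.symm
  have hforest : IsTerminalForest b (H.comap e) ↔ IsTerminalForest (e ∘ b) H := by
    refine ⟨fun h => ⟨φ.isAcyclic_iff.1 h.isAcyclic, e.forall_congr_right.1 fun v => ?_⟩,
      fun h => ⟨φ.isAcyclic_iff.2 h.isAcyclic, fun v => ?_⟩⟩
    · obtain ⟨i, hi⟩ := h.exists_reachable v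
      exact ⟨i, φ.reachable_iff.2 hi⟩
    · obtain ⟨i, hi⟩ := h.exists_reachable (e v)
      exact ⟨i, φ.reachable_iff.1 hi⟩
  simp only [terminalForests, Set.mem_ofPred_eq, hle, hforest, hpartition]

theorem ncard_terminalForests_comap (e : V ≃ W) (G : SimpleGraph W) :
    (terminalForests b (G.comap e) r).ncard = (terminalForests (e ∘ b) G r).ncard := by
  have hpreimage : e.symm.simpleGraph ⁻¹' terminalForests b (G.comap e) r =
      terminalForests (e ∘ b) G r :=
    Set.ext fun _ => comap_mem_terminalForests_iff e
  rw [← hpreimage, Set.ncard_preimage_of_injective_subset_range e.symm.simpleGraph.injective]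
  simp

end TerminalForest

section Gluing

open SimpleGraph

variable {ι V W : Type*}

/-- The partition of the corners of all copies generated by a partition `r i` of the corners of
each copy `i` and by the identification of the corner `j` of copy `i`, denoted `(i, j)`, with the
corner `i` of copy `j`. -/
def glueSetoid (r : ι → Setoid ι) : Setoid (ι × ι) :=
  Relation.EqvGen.setoid fun p q => (p.1 = q.1 ∧ r p.1 p.2 q.2) ∨ q = p.swap

theorem glueSetoid_le_iff {r : ι → Setoid ι} {s : Setoid (ι × ι)} :
    glueSetoid r ≤ s ↔ (∀ i j k, r i j k → s (i, j) (i, k)) ∧ ∀ i j, s (i, j) (j, i) := by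
  refine ⟨fun h => ⟨fun i j k hjk => h (.rel _ _ (.inl ⟨rfl, hjk⟩)),
    fun i j => h (.rel _ _ (.inr rfl))⟩, fun ⟨hpiece, hswap⟩ => Setoid.eqvGen_le ?_⟩
  rintro ⟨i, j⟩ ⟨i', k⟩ (⟨rfl, hjk⟩ | hq)
  · exact hpiece i j k hjk
  · cases hq
    exact hswap i j

theorem glueSetoid_of_rel {r : ι → Setoid ι} {i j k : ι} (h : r i j k) :
    glueSetoid r (i, j) (i, k) :=
  (glueSetoid_le_iff.1 le_rfl).1 i j k h

theorem glueSetoid_swap (r : ι → Setoid ι) (i j : ι) : glueSetoid r (i, j) (j, i) :=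
  (glueSetoid_le_iff.1 le_rfl).2 i j

/-- Copies of `V`, one for each of its corners `b`, are glued to `W` by the embeddings `f`: any two
copies `i` and `j` have just one point in common, which is the corner `j` of copy `i` and the
corner `i` of copy `j`. -/
structure IsCornerGluing (f : ι → V ↪ W) (b : ι → V) : Prop where
  injective : Function.Injective b
  comm : ∀ i j, f i (b j) = f j (b i)
  eq_corner : ∀ {i j x y}, i ≠ j → f i x = f j y → x = b j ∧ y = b i
  cover : ∀ v, ∃ i x, f i x = v

/-- The union of one graph on each of the copies. -/
def glueGraph (f : ι → V ↪ W) (h : ι → SimpleGraph V) : SimpleGraph W :=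
  ⨆ i, (h i).map (f i)

theorem glueGraph_adj {f : ι → V ↪ W} {h : ι → SimpleGraph V} {v w : W} :
    (glueGraph f h).Adj v w ↔ ∃ i x y, (h i).Adj x y ∧ f i x = v ∧ f i y = w := by
  simp only [glueGraph, iSup_adj, map_adj]

theorem glueGraph_mono {f : ι → V ↪ W} {h h' : ι → SimpleGraph V} (hle : ∀ i, h i ≤ h' i) :
    glueGraph f h ≤ glueGraph f h' :=
  iSup_mono fun i => map_monotone _ (hle i)

theorem glueGraph_comap {f : ι → V ↪ W} {g : ι → SimpleGraph V} {H : SimpleGraph W}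
    (hH : H ≤ glueGraph f g) : glueGraph f (fun i => H.comap (f i)) = H := by
  ext v w
  rw [glueGraph_adj]
  constructor
  · rintro ⟨i, x, y, hadj, rfl, rfl⟩
    exact hadj
  · intro hadj
    obtain ⟨i, x, y, -, rfl, rfl⟩ := glueGraph_adj.1 (hH hadj)
    exact ⟨i, x, y, hadj, rfl, rfl⟩

namespace IsCornerGluing

variable {f : ι → V ↪ W} {b : ι → V} (hf : IsCornerGluing f b) (h : ι → SimpleGraph V)

include hf

theorem comap_glueGraph (i : ι) : (glueGraph f h).comap (f i) = h i := by
  ext x y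
  rw [comap_adj, glueGraph_adj]
  constructor
  · rintro ⟨j, x', y', hadj, hx, hy⟩
    rcases eq_or_ne j i with rfl | hij
    · rwa [← (f j).injective hx, ← (f j).injective hy]
    · exact absurd ((hf.eq_corner hij hx).1.trans (hf.eq_corner hij hy).1.symm) hadj.ne
  · exact fun hadj => ⟨i, x, y, hadj, rfl, rfl⟩

theorem glueGraph_injective : Function.Injective (glueGraph f) := fun h h' heq => by
  funext i
  rw [← hf.comap_glueGraph h, heq, hf.comap_glueGraph]

theorem disjoint_map {i j : ι} (hij : i ≠ j) (G H : SimpleGraph V) :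
    Disjoint (G.map (f i)) (H.map (f j)) := by
  refine disjoint_left.2 fun v w hG hH => ?_
  obtain ⟨x, y, hxy, rfl, rfl⟩ := (map_adj ..).1 hG
  obtain ⟨x', y', -, hx, hy⟩ := (map_adj ..).1 hH
  exact hxy.ne ((hf.eq_corner hij hx.symm).1.trans (hf.eq_corner hij hy.symm).1.symm)

theorem ncard_edgeSet_glueGraph [Fintype ι] [Finite V] :
    (glueGraph f h).edgeSet.ncard = ∑ i, (h i).edgeSet.ncard := by
  have hdisj : Pairwise (Function.onFun Disjoint fun i => ((h i).map (f i)).edgeSet) :=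
    fun i j hij => disjoint_edgeSet.2 (hf.disjoint_map hij _ _)
  have hcard (i) : ((h i).map (f i)).edgeSet.ncard = (h i).edgeSet.ncard := by
    rw [edgeSet_map, Set.ncard_image_of_injective _ (f i).sym2Map.injective]
  have hfin (i) : ((h i).map (f i)).edgeSet.Finite := by
    rw [edgeSet_map]
    exact (Set.toFinite _).image _
  rw [glueGraph, edgeSet_iSup, Set.ncard_iUnion_of_finite hfin hdisj, finsum_eq_sum_of_fintype]
  exact Finset.sum_congr rfl fun i _ => hcard i

theorem bijOn_of_linearOrder [LinearOrder ι] :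
    Set.BijOn (fun q : ι × V => f q.1 q.2) {q | ∃ j < q.1, b j = q.2}ᶜ Set.univ := by
  refine ⟨Set.mapsTo_univ _ _, ?_, fun w _ => ?_⟩
  · rintro ⟨i, x⟩ hx ⟨j, y⟩ hy (hxy : f i x = f j y)
    rcases eq_or_ne i j with rfl | hij
    · exact Prod.ext rfl ((f i).injective hxy)
    obtain ⟨rfl, rfl⟩ := hf.eq_corner hij hxy
    rcases hij.lt_or_gt with hlt | hlt
    exacts [absurd ⟨i, hlt, rfl⟩ hy, absurd ⟨j, hlt, rfl⟩ hx]
  · obtain ⟨i, x, rfl⟩ := hf.cover w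
    by_cases hx : ∃ j < i, b j = x
    · obtain ⟨j, hji, rfl⟩ := hx
      refine ⟨(j, b i), ?_, hf.comm j i⟩
      rintro ⟨k, hkj, hk⟩
      exact hji.asymm (hf.injective hk ▸ hkj)
    · exact ⟨(i, x), hx, rfl⟩

theorem card_add_choose [Fintype ι] [Finite V] :
    Nat.card W + (Fintype.card ι).choose 2 = Fintype.card ι * Nat.card V := by
  let _ : LinearOrder ι := LinearOrder.lift' (Fintype.equivFin ι) (Fintype.equivFin ι).injective
  have hshared : {q : ι × V | ∃ j < q.1, b j = q.2}.ncard = (Fintype.card ι).choose 2 := by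
    have himage : {q : ι × V | ∃ j < q.1, b j = q.2} =
        (fun p : ι × ι => (p.2, b p.1)) '' {p | p.1 < p.2} := by
      ext ⟨i, x⟩
      simp [and_comm]
    rw [himage, Set.ncard_image_of_injective _ fun p q hpq =>
        Prod.ext (hf.injective (congrArg Prod.snd hpq)) (congrArg Prod.fst hpq),
      ← Fintype.card_product_filter_lt, ← Set.ncard_coe_finset, Finset.coe_filter_univ]
  have hbij := hf.bijOn_of_linearOrder
  rw [← Set.ncard_univ W, ← hbij.image_eq, hbij.injOn.ncard_image, ← hshared, add_comm,
    Set.ncard_add_ncard_compl, Nat.card_prod, Nat.card_eq_fintype_card]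

end IsCornerGluing

variable {f : ι → V ↪ W} {b : ι → V} {h : ι → SimpleGraph V}

theorem reachable_glueGraph {i : ι} {x y : V} (hxy : (h i).Reachable x y) :
    (glueGraph f h).Reachable (f i x) (f i y) :=
  hxy.map ⟨f i, fun hadj => glueGraph_adj.2 ⟨i, _, _, hadj, rfl, rfl⟩⟩

namespace IsCornerGluing

variable (hf : IsCornerGluing f b)

include hf

theorem exists_glueSetoid_of_apply_eq {p : ι × ι} {i k : ι} {x z : V}
    (hzx : f k z = f i x)
    (hz : ∃ j, glueSetoid (fun i => terminalPartition b (h i)) p (k, j) ∧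
      (h k).Reachable (b j) z) :
    ∃ j, glueSetoid (fun i => terminalPartition b (h i)) p (i, j) ∧ (h i).Reachable (b j) x := by
  rcases eq_or_ne k i with rfl | hki
  · rwa [← (f k).injective hzx]
  obtain ⟨rfl, rfl⟩ := hf.eq_corner hki hzx
  obtain ⟨j, hpj, hj⟩ := hz
  have hji : glueSetoid (fun i => terminalPartition b (h i)) (k, j) (k, i) := glueSetoid_of_rel hj
  exact ⟨k, Setoid.trans' _ hpj (Setoid.trans' _ hji (glueSetoid_swap _ k i)), .rfl⟩

theorem exists_glueSetoid_of_reachable {p : ι × ι} {w : W}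
    (hw : (glueGraph f h).Reachable (f p.1 (b p.2)) w) {i : ι} {x : V} (hx : f i x = w) :
    ∃ j, glueSetoid (fun i => terminalPartition b (h i)) p (i, j) ∧ (h i).Reachable (b j) x := by
  rw [reachable_iff_reflTransGen] at hw
  induction hw generalizing i x with
  | refl => exact hf.exists_glueSetoid_of_apply_eq hx.symm ⟨p.2, Setoid.refl' _ _, .rfl⟩
  | tail _ hadj ih =>
    obtain ⟨k, y, z, hyz, hy, hz⟩ := glueGraph_adj.1 hadj
    obtain ⟨j, hpj, hj⟩ := ih hy
    exact hf.exists_glueSetoid_of_apply_eq (hz.trans hx.symm) ⟨j, hpj, hj.trans hyz.reachable⟩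

theorem terminalPartition_glueGraph :
    terminalPartition (fun p : ι × ι => f p.1 (b p.2)) (glueGraph f h) =
      glueSetoid fun i => terminalPartition b (h i) := by
  refine le_antisymm (fun p q hpq => ?_) (glueSetoid_le_iff.2 ⟨fun i j k hjk => ?_, fun i j => ?_⟩)
  · obtain ⟨j, hpj, hj⟩ := hf.exists_glueSetoid_of_reachable hpq rfl
    exact Setoid.trans' _ hpj (glueSetoid_of_rel hj)
  · exact reachable_glueGraph hjk
  · change (glueGraph f h).Reachable (f i (b j)) (f j (b i))
    rw [hf.comm]

theorem terminalPartition_glueGraph_outer :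
    terminalPartition (fun i => f i (b i)) (glueGraph f h) =
      (glueSetoid fun i => terminalPartition b (h i)).comap fun i => (i, i) := by
  rw [← hf.terminalPartition_glueGraph]
  rfl

theorem exists_reachable_glueGraph_iff :
    (∀ w, ∃ k, (glueGraph f h).Reachable (f k (b k)) w) ↔
      (∀ i x, ∃ j, (h i).Reachable (b j) x) ∧
        ∀ p, ∃ k, glueSetoid (fun i => terminalPartition b (h i)) (k, k) p := by
  constructor
  · refine fun hglue => ⟨fun i x => ?_, fun p => ?_⟩
    · obtain ⟨k, hk⟩ := hglue (f i x)
      obtain ⟨j, -, hj⟩ := hf.exists_glueSetoid_of_reachable (p := (k, k)) hk rfl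
      exact ⟨j, hj⟩
    · obtain ⟨k, hk⟩ := hglue (f p.1 (b p.2))
      exact ⟨k, hf.terminalPartition_glueGraph ▸ hk⟩
  · rintro ⟨hpiece, houter⟩ w
    obtain ⟨i, x, rfl⟩ := hf.cover w
    obtain ⟨j, hj⟩ := hpiece i x
    obtain ⟨k, hk⟩ := houter (i, j)
    rw [← hf.terminalPartition_glueGraph] at hk
    exact ⟨k, Reachable.trans hk (reachable_glueGraph hj)⟩

theorem isTerminalForest_glueGraph_iff [Fintype ι] [Finite V] [Finite W] :
    IsTerminalForest (fun i => f i (b i)) (glueGraph f h) ↔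
      (∀ i, IsTerminalForest b (h i)) ∧
      (∀ p, ∃ k, glueSetoid (fun i => terminalPartition b (h i)) (k, k) p) ∧
      ∑ i, Nat.card (Quotient (terminalPartition b (h i))) =
        Nat.card (Quotient (terminalPartition (fun i => f i (b i)) (glueGraph f h))) +
          (Fintype.card ι).choose 2 := by
  by_cases hreach : ∀ w, ∃ k, (glueGraph f h).Reachable (f k (b k)) w
  swap
  · refine iff_of_false (fun hglue => hreach hglue.exists_reachable) fun hpiece => hreach ?_
    exact hf.exists_reachable_glueGraph_iff.2 ⟨fun i => (hpiece.1 i).exists_reachable, hpiece.2.1⟩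
  obtain ⟨hpiece, houter⟩ := hf.exists_reachable_glueGraph_iff.1 hreach
  have hpieces (hglue : IsTerminalForest (fun i => f i (b i)) (glueGraph f h)) (i) :
      IsTerminalForest b (h i) := by
    refine ⟨?_, hpiece i⟩
    rw [← hf.comap_glueGraph h i]
    exact hglue.isAcyclic.comap ⟨f i, id⟩ (f i).injective
  rw [← and_iff_right_of_imp hpieces]
  refine and_congr_right fun hforest => ?_
  rw [and_iff_right houter, isTerminalForest_iff_ncard_edgeSet hreach, hf.ncard_edgeSet_glueGraph]
  have hsum : ∑ i, (h i).edgeSet.ncard + ∑ i, Nat.card (Quotient (terminalPartition b (h i))) =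
      Fintype.card ι * Nat.card V := by
    rw [← Finset.sum_add_distrib, ← smul_eq_mul, ← Finset.card_univ, ← Finset.sum_const]
    exact Finset.sum_congr rfl fun i _ =>
      (isTerminalForest_iff_ncard_edgeSet (hpiece i)).1 (hforest i)
  have := hf.card_add_choose
  omega

end IsCornerGluing

/-- Terminal forests of the copies which induce the partitions `r i` on the corners of copy `i`
form together a terminal forest inducing the partition `s` on the outer corners. -/
structure GluesTo [Fintype ι] (r : ι → Setoid ι) (s : Setoid ι) : Prop where
  partition : (glueSetoid r).comap (fun i => (i, i)) = s
  exists_outer : ∀ p, ∃ k, glueSetoid r (k, k) p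
  -- By Euler's formula, this says that no cycle arises.
  card : ∑ i, Nat.card (Quotient (r i)) = Nat.card (Quotient s) + (Fintype.card ι).choose 2

namespace IsCornerGluing

variable [Fintype ι] [Finite V] [Finite W] (hf : IsCornerGluing f b) {r : ι → Setoid ι}
  {s : Setoid ι} {g : ι → SimpleGraph V}

include hf

theorem isTerminalForest_and_terminalPartition_glueGraph_iff :
    IsTerminalForest (fun i => f i (b i)) (glueGraph f h) ∧
        terminalPartition (fun i => f i (b i)) (glueGraph f h) = s ↔
      (∀ i, IsTerminalForest b (h i)) ∧ GluesTo (fun i => terminalPartition b (h i)) s := by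
  rw [hf.isTerminalForest_glueGraph_iff, and_assoc, and_congr_right_iff]
  intro _
  constructor
  · rintro ⟨⟨houter, hcard⟩, rfl⟩
    exact ⟨hf.terminalPartition_glueGraph_outer.symm, houter, hcard⟩
  · rintro ⟨rfl, houter, hcard⟩
    rw [hf.terminalPartition_glueGraph_outer]
    exact ⟨⟨houter, hcard⟩, rfl⟩

theorem glueGraph_mem_terminalForests_iff :
    glueGraph f h ∈ terminalForests (fun i => f i (b i)) (glueGraph f g) s ↔
      (∀ i, h i ∈ terminalForests b (g i) (terminalPartition b (h i))) ∧
        GluesTo (fun i => terminalPartition b (h i)) s := by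
  have hle : glueGraph f h ≤ glueGraph f g ↔ ∀ i, h i ≤ g i := by
    refine ⟨fun hle i => ?_, glueGraph_mono⟩
    rw [← hf.comap_glueGraph h, ← hf.comap_glueGraph g]
    exact comap_monotone _ hle
  simp only [terminalForests, Set.mem_ofPred_eq, and_true, forall_and, hle, and_assoc,
    hf.isTerminalForest_and_terminalPartition_glueGraph_iff]

theorem terminalForests_glueGraph {τ : Type*} (e : τ ≃ Setoid ι) :
    terminalForests (fun i => f i (b i)) (glueGraph f g) s = glueGraph f ''
      ⋃ t ∈ {t : ι → τ | GluesTo (fun i => e (t i)) s},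
        Set.univ.pi fun i => terminalForests b (g i) (e (t i)) := by
  ext H
  simp only [Set.mem_image, Set.mem_iUnion, Set.mem_univ_pi, Set.mem_ofPred_eq]
  constructor
  · intro hH
    have hglue := glueGraph_comap hH.1
    rw [← hglue, hf.glueGraph_mem_terminalForests_iff] at hH
    exact ⟨_, ⟨fun i => e.symm (terminalPartition b (H.comap (f i))), by simpa using hH.2,
      by simpa using hH.1⟩, hglue⟩
  · rintro ⟨h, ⟨t, ht, hh⟩, rfl⟩
    obtain rfl : t = fun i => e.symm (terminalPartition b (h i)) :=
      funext fun i => (e.symm_apply_eq.2 (hh i).2.2).symm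
    exact hf.glueGraph_mem_terminalForests_iff.2 ⟨by simpa using hh, by simpa using ht⟩

theorem ncard_terminalForests_glueGraph [DecidableEq ι] {τ : Type*} [Fintype τ]
    (e : τ ≃ Setoid ι) [DecidablePred fun t : ι → τ => GluesTo (fun i => e (t i)) s] :
    (terminalForests (fun i => f i (b i)) (glueGraph f g) s).ncard =
      ∑ t : ι → τ with GluesTo (fun i => e (t i)) s,
        ∏ i, (terminalForests b (g i) (e (t i))).ncard := by
  have hdisj : {t : ι → τ | GluesTo (fun i => e (t i)) s}.PairwiseDisjoint
      fun t => Set.univ.pi fun i => terminalForests b (g i) (e (t i)) := by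
    refine fun t _ t' _ htt' => Set.disjoint_left.2 fun h ht ht' => htt' (funext fun i => ?_)
    exact e.injective ((ht i trivial).2.2.symm.trans (ht' i trivial).2.2)
  have hprod (t : ι → τ) : (Set.univ.pi fun i => terminalForests b (g i) (e (t i))).ncard =
      ∏ i, (terminalForests b (g i) (e (t i))).ncard := by
    simp only [← Nat.card_coe_set_eq, ← Nat.card_pi]
    exact Nat.card_congr (Equiv.Set.univPi _)
  rw [hf.terminalForests_glueGraph e, Set.ncard_image_of_injective _ hf.glueGraph_injective,
    (Set.toFinite _).ncard_biUnion (fun _ _ => Set.toFinite _) hdisj, ← Finset.coe_filter_univ,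
    finsum_mem_coe_finset]
  exact Finset.sum_congr rfl fun t _ => hprod t

end IsCornerGluing

end Gluing

/-- The five partitions of three corners: one class, the class `{k}` and its complement, or three
classes. -/
inductive CornerType
  | connected
  | isolated (k : Fin 3)
  | separated
  deriving DecidableEq, Fintype

namespace CornerType

/-- A labelling of the corners whose fibres are the classes of the partition. -/
def label : CornerType → Fin 3 → Fin 3
  | connected, _ => 0
  | isolated k, i => if i = k then 1 else 0
  | separated, i => i

/-- The number of classes of the partition. -/
def numClasses : CornerType → ℕ
  | connected => 1
  | isolated _ => 2
  | separated => 3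

theorem ker_label_injective : Function.Injective fun t : CornerType => Setoid.ker t.label := by
  have hlabel : ∀ t u : CornerType,
      (∀ i j, t.label i = t.label j ↔ u.label i = u.label j) → t = u := by decide
  intro t u (htu : Setoid.ker t.label = Setoid.ker u.label)
  exact hlabel t u fun i j => Setoid.ext_iff.1 htu i j

theorem ker_label_eq {t : CornerType} {s : Setoid (Fin 3)} (h01 : t.label 0 = t.label 1 ↔ s 0 1)
    (h02 : t.label 0 = t.label 2 ↔ s 0 2) (h12 : t.label 1 = t.label 2 ↔ s 1 2) :
    Setoid.ker t.label = s := by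
  ext i j
  rw [Setoid.ker_def]
  fin_cases i <;> fin_cases j
  exacts [iff_of_true rfl (s.refl' _), h01, h02, eq_comm.trans (h01.trans s.comm'),
    iff_of_true rfl (s.refl' _), h12, eq_comm.trans (h02.trans s.comm'),
    eq_comm.trans (h12.trans s.comm'), iff_of_true rfl (s.refl' _)]

theorem ker_label_surjective : Function.Surjective fun t : CornerType => Setoid.ker t.label := by
  intro s
  by_cases h01 : s 0 1 <;> by_cases h02 : s 0 2
  · have h12 : s 1 2 := s.trans' (s.symm' h01) h02
    exact ⟨connected, ker_label_eq (by simpa [label]) (by simpa [label]) (by simpa [label])⟩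
  · have h12 : ¬ s 1 2 := fun h12 => h02 (s.trans' h01 h12)
    exact ⟨isolated 2, ker_label_eq (by simpa [label]) (by simpa [label]) (by simpa [label])⟩
  · have h12 : ¬ s 1 2 := fun h12 => h01 (s.trans' h02 (s.symm' h12))
    exact ⟨isolated 1, ker_label_eq (by simpa [label]) (by simpa [label]) (by simpa [label])⟩
  by_cases h12 : s 1 2
  · exact ⟨isolated 0, ker_label_eq (by simpa [label]) (by simpa [label]) (by simpa [label])⟩
  · exact ⟨separated, ker_label_eq (by simpa [label]) (by simpa [label]) (by simpa [label])⟩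

/-- The corner types are all the partitions of the three corners. -/
noncomputable def equivSetoid : CornerType ≃ Setoid (Fin 3) :=
  Equiv.ofBijective (fun t => Setoid.ker t.label) ⟨ker_label_injective, ker_label_surjective⟩

theorem card_quotient_equivSetoid (t : CornerType) :
    Nat.card (Quotient (equivSetoid t)) = t.numClasses := by
  have hrange : ∀ t : CornerType, (Finset.univ.image t.label).card = t.numClasses := by decide
  have hset : Set.range t.label = Finset.univ.image t.label := by simp
  rw [← hrange, ← Set.ncard_coe_finset, ← hset, ← Nat.card_coe_set_eq]
  exact Nat.card_congr (Setoid.quotientKerEquivRange t.label)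

/-- A labelling whose fibres are the classes of `glueSetoid`, computed by merging the three pairs
of identified corners one after the other. -/
def glueLabel (t : Fin 3 → CornerType) : Fin 3 × Fin 3 → Fin 3 × Fin 3 :=
  mergeLabels (mergeLabels (mergeLabels (fun p => (p.1, (t p.1).label p.2))
    (0, 1) (1, 0)) (0, 2) (2, 0)) (1, 2) (2, 1)

theorem ker_glueLabel (t : Fin 3 → CornerType) :
    Setoid.ker (glueLabel t) = glueSetoid fun i => equivSetoid (t i) := by
  refine eq_of_forall_ge_iff fun s => ?_
  rw [glueLabel, ker_mergeLabels_le_iff, ker_mergeLabels_le_iff, ker_mergeLabels_le_iff,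
    glueSetoid_le_iff, and_assoc, and_assoc]
  refine and_congr ⟨fun h i j k hjk => h (Prod.ext rfl hjk), ?_⟩ ?_
  · rintro h ⟨i, j⟩ ⟨i', k⟩ hjk
    obtain rfl : i = i' := congrArg Prod.fst hjk
    exact h i j k (congrArg Prod.snd hjk)
  · refine ⟨fun ⟨h01, h02, h12⟩ i j => ?_, fun h => ⟨h 0 1, h 0 2, h 1 2⟩⟩
    fin_cases i <;> fin_cases j
    exacts [s.refl' _, h01, h02, s.symm' h01, s.refl' _, h12, s.symm' h02, s.symm' h12, s.refl' _]

theorem gluesTo_iff {t : Fin 3 → CornerType} {u : CornerType} :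
    GluesTo (fun i => equivSetoid (t i)) (equivSetoid u) ↔
      (∀ i j, glueLabel t (i, i) = glueLabel t (j, j) ↔ u.label i = u.label j) ∧
      (∀ p, ∃ k, glueLabel t (k, k) = glueLabel t p) ∧
      ∑ i, (t i).numClasses = u.numClasses + 3 := by
  have hpartition : (glueSetoid fun i => equivSetoid (t i)).comap (fun i => (i, i)) =
      equivSetoid u ↔ ∀ i j, glueLabel t (i, i) = glueLabel t (j, j) ↔ u.label i = u.label j := by
    rw [← ker_glueLabel, Setoid.ext_iff]
    rfl
  have houter (p) : (∃ k, (glueSetoid fun i => equivSetoid (t i)) (k, k) p) ↔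
      ∃ k, glueLabel t (k, k) = glueLabel t p := by
    rw [← ker_glueLabel]
    rfl
  have hcard : ∑ i, Nat.card (Quotient (equivSetoid (t i))) =
      Nat.card (Quotient (equivSetoid u)) + (Fintype.card (Fin 3)).choose 2 ↔
        ∑ i, (t i).numClasses = u.numClasses + 3 := by
    simp only [card_quotient_equivSetoid]
    rfl
  simp only [← hpartition, ← houter, ← hcard]
  exact ⟨fun h => ⟨h.partition, h.exists_outer, h.card⟩, fun h => ⟨h.1, h.2.1, h.2.2⟩⟩

instance (u : CornerType) : DecidablePred fun t : Fin 3 → CornerType =>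
    GluesTo (fun i => equivSetoid (t i)) (equivSetoid u) :=
  fun _ => decidable_of_iff' _ gluesTo_iff

/-- The types of the three copies for which the union of the three forests is a forest of type `u`.
-/
def gluings (u : CornerType) : Finset (Fin 3 → CornerType) :=
  {t | GluesTo (fun i => equivSetoid (t i)) (equivSetoid u)}

/-- The numbers of classes of the types of the three copies. -/
def profile (t : Fin 3 → CornerType) : Multiset ℕ :=
  Finset.univ.val.map fun i => (t i).numClasses

theorem map_profile_gluings_connected : (gluings connected).val.map profile =
    .replicate 6 {1, 1, 2} := by
  decide +kernel

theorem map_profile_gluings_isolated (k : Fin 3) : (gluings (isolated k)).val.map profile =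
    .replicate 1 {1, 1, 3} + .replicate 7 {1, 2, 2} := by
  decide +revert +kernel

theorem map_profile_gluings_separated : (gluings separated).val.map profile =
    .replicate 12 {1, 2, 3} + .replicate 14 {2, 2, 2} := by
  decide +kernel

section Sum

variable {R : Type*} [CommSemiring R] (w : ℕ → R)

theorem sum_prod_numClasses (s : Finset (Fin 3 → CornerType)) :
    ∑ t ∈ s, ∏ i, w (t i).numClasses =
      ((s.val.map profile).map fun m => (m.map w).prod).sum := by
  simp only [Finset.sum, Finset.prod, profile, Multiset.map_map, Function.comp_def]

theorem sum_gluings_connected :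
    ∑ t ∈ gluings connected, ∏ i, w (t i).numClasses = 6 * (w 1 ^ 2 * w 2) := by
  rw [sum_prod_numClasses, map_profile_gluings_connected]
  simp only [Multiset.map_replicate, Multiset.sum_replicate, Multiset.insert_eq_cons,
    Multiset.map_cons, Multiset.map_singleton, Multiset.prod_cons, Multiset.prod_singleton,
    nsmul_eq_mul]
  push_cast
  ring

theorem sum_gluings_isolated (k : Fin 3) :
    ∑ t ∈ gluings (isolated k), ∏ i, w (t i).numClasses = w 1 ^ 2 * w 3 + 7 * (w 1 * w 2 ^ 2) := by
  rw [sum_prod_numClasses, map_profile_gluings_isolated]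
  simp only [Multiset.map_add, Multiset.map_replicate, Multiset.sum_add, Multiset.sum_replicate,
    Multiset.insert_eq_cons, Multiset.map_cons, Multiset.map_singleton, Multiset.prod_cons,
    Multiset.prod_singleton, nsmul_eq_mul]
  push_cast
  ring

theorem sum_gluings_separated :
    ∑ t ∈ gluings separated, ∏ i, w (t i).numClasses = 12 * (w 1 * w 2 * w 3) + 14 * w 2 ^ 3 := by
  rw [sum_prod_numClasses, map_profile_gluings_separated]
  simp only [Multiset.map_add, Multiset.map_replicate, Multiset.sum_add, Multiset.sum_replicate,
    Multiset.insert_eq_cons, Multiset.map_cons, Multiset.map_singleton, Multiset.prod_cons,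
    Multiset.prod_singleton, nsmul_eq_mul]
  push_cast
  ring

end Sum

end CornerType

section CornerPartition

open CornerType

variable {V : Type*} [Finite V] {b : Fin 3 → V} {G H : SimpleGraph V}

theorem mem_terminalForests_equivSetoid_iff {t : CornerType} :
    H ∈ terminalForests b G (equivSetoid t) ↔
      IsSpanningForest G t.numClasses H ∧ terminalPartition b H = equivSetoid t := by
  rw [terminalForests, Set.mem_ofPred_eq, ← and_assoc, ← isSpanningForest_card_quotient_iff]
  refine and_congr_left fun h => ?_
  rw [h, card_quotient_equivSetoid]

theorem eq_equivSetoid_isolated_iff {r : Setoid (Fin 3)} {i j k : Fin 3} (hij : i ≠ j)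
    (hik : i ≠ k) (hjk : j ≠ k) : r = equivSetoid (isolated k) ↔ r i j ∧ ¬ r i k := by
  have hlabel (t : CornerType) : t = isolated k ↔
      t.label i = t.label j ∧ ¬ t.label i = t.label k := by
    cases t <;> decide +revert
  obtain ⟨t, rfl⟩ := equivSetoid.surjective r
  exact equivSetoid.injective.eq_iff.trans (hlabel t)

theorem eq_equivSetoid_separated_iff {r : Setoid (Fin 3)} :
    r = equivSetoid separated ↔ ∀ i j, i ≠ j → ¬ r i j := by
  have hlabel : ∀ t : CornerType, t = separated ↔
      ∀ i j, i ≠ j → ¬ t.label i = t.label j := by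
    decide
  obtain ⟨t, rfl⟩ := equivSetoid.surjective r
  exact equivSetoid.injective.eq_iff.trans (hlabel t)

theorem equivSetoid_connected : equivSetoid connected = ⊤ :=
  Setoid.eq_top_iff.2 fun _ _ => rfl

end CornerPartition

section Triangle

open SimpleGraph CornerType

/-- The spanning subgraph of the triangle consisting of the edges opposite to the vertices in `s`.
-/
def triangleSubgraph (s : Finset (Fin 3)) : SimpleGraph (Fin 3) where
  Adj i j := i ≠ j ∧ ∃ k ∈ s, k ≠ i ∧ k ≠ j
  symm := ⟨by revert s; decide⟩
  loopless := ⟨by revert s; decide⟩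

instance (s : Finset (Fin 3)) : DecidableRel (triangleSubgraph s).Adj := fun i j =>
  inferInstanceAs (Decidable (i ≠ j ∧ ∃ k ∈ s, k ≠ i ∧ k ≠ j))

theorem triangleSubgraph_bijective : Function.Bijective triangleSubgraph := by
  classical
  have hadj : ∀ (s : Finset (Fin 3)) k, (triangleSubgraph s).Adj (k + 1) (k + 2) ↔ k ∈ s := by
    decide
  refine ⟨fun s t h => Finset.ext fun k => ?_, fun H => ?_⟩
  · rw [← hadj, h, hadj]
  · have hedge : ∀ i j : Fin 3, i ≠ j → ∃ k, i = k + 1 ∧ j = k + 2 ∨ i = k + 2 ∧ j = k + 1 := by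
      decide
    let s : Finset (Fin 3) := {k | H.Adj (k + 1) (k + 2)}
    have hopposite (k) : (triangleSubgraph s).Adj (k + 1) (k + 2) ↔ H.Adj (k + 1) (k + 2) := by
      rw [hadj, Finset.mem_filter_univ]
    refine ⟨s, ?_⟩
    ext i j
    rcases eq_or_ne i j with rfl | hij
    · simp
    obtain ⟨k, ⟨rfl, rfl⟩ | ⟨rfl, rfl⟩⟩ := hedge i j hij
    exacts [hopposite k, (adj_comm ..).trans ((hopposite k).trans (adj_comm ..))]

theorem triangleSubgraph_reachable_iff {s : Finset (Fin 3)} {i j : Fin 3} :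
    (triangleSubgraph s).Reachable i j ↔ i = j ∨ (triangleSubgraph s).Adj i j ∨
      ∃ k, (triangleSubgraph s).Adj i k ∧ (triangleSubgraph s).Adj k j := by
  constructor
  · rintro ⟨p⟩
    induction p with
    | nil => exact .inl rfl
    | @cons a c d hadj p ih =>
      clear p
      revert s a c d
      decide
  · rintro (rfl | h | ⟨k, h, h'⟩)
    exacts [.refl _, h.reachable, h.reachable.trans h'.reachable]

theorem triangleSubgraph_mem_terminalForests_iff {s : Finset (Fin 3)} {t : CornerType} :
    triangleSubgraph s ∈ terminalForests id ⊤ (equivSetoid t) ↔ s.card + t.numClasses = 3 ∧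
      ∀ i j, (i = j ∨ (triangleSubgraph s).Adj i j ∨
        ∃ k, (triangleSubgraph s).Adj i k ∧ (triangleSubgraph s).Adj k j) ↔
          t.label i = t.label j := by
  have hedges : (triangleSubgraph s).edgeSet.ncard = s.card := by
    rw [← coe_edgeFinset, Set.ncard_coe_finset]
    decide +revert
  have hpartition : terminalPartition id (triangleSubgraph s) = equivSetoid t ↔
      ∀ i j, (triangleSubgraph s).Reachable i j ↔ t.label i = t.label j :=
    Setoid.ext_iff
  simp only [← triangleSubgraph_reachable_iff, ← hpartition]
  rw [terminalForests, Set.mem_ofPred_eq, and_iff_right le_top, and_congr_left_iff,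
    isTerminalForest_iff_ncard_edgeSet (b := id) fun v => ⟨v, .rfl⟩]
  intro h
  rw [h, hedges, card_quotient_equivSetoid, Nat.card_eq_fintype_card, Fintype.card_fin]

theorem ncard_terminalForests_triangle (t : CornerType) :
    (terminalForests id (⊤ : SimpleGraph (Fin 3)) (equivSetoid t)).ncard =
      if t.numClasses = 1 then 3 else 1 := by
  rw [← Set.ncard_preimage_of_injective_subset_range triangleSubgraph_bijective.injective
    (by simp [triangleSubgraph_bijective.surjective.range_eq])]
  simp only [Set.preimage, triangleSubgraph_mem_terminalForests_iff]
  rw [← Finset.coe_filter_univ, Set.ncard_coe_finset]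
  revert t
  decide +kernel

theorem ncard_terminalForests_of_bijective {V : Type*} {b : Fin 3 → V} (hb : Function.Bijective b)
    (t : CornerType) :
    (terminalForests b (⊤ : SimpleGraph V) (equivSetoid t)).ncard =
      if t.numClasses = 1 then 3 else 1 := by
  have htop : (⊤ : SimpleGraph V).comap (Equiv.ofBijective b hb) = ⊤ := by
    ext i j
    exact hb.injective.ne_iff
  rw [← ncard_terminalForests_triangle t, ← htop, ncard_terminalForests_comap]
  rfl

end Triangle

section Sierpinski

theorem add_le_of_mem_sierpinskiVertices {n : ℕ} {p : ℕ × ℕ} (hp : p ∈ sierpinskiVertices n) :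
    p.1 + p.2 ≤ 2 ^ n := by
  induction n generalizing p with
  | zero =>
    simp only [sierpinskiVertices, Finset.mem_insert, Finset.mem_singleton] at hp
    rcases hp with rfl | rfl | rfl <;> simp
  | succ n ih =>
    simp only [sierpinskiVertices, Finset.mem_union, Finset.mem_map, latticeShift,
      addRightEmbedding_apply] at hp
    rw [pow_succ]
    rcases hp with (hp | ⟨q, hq, rfl⟩) | ⟨q, hq, rfl⟩
    · have := ih hp
      omega
    · have := ih hq
      simp only [Prod.fst_add, Prod.snd_add]
      omega
    · have := ih hq
      simp only [Prod.fst_add, Prod.snd_add]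
      omega

theorem sierpinskiCornerPoint_injective (n : ℕ) :
    Function.Injective (sierpinskiCornerPoint n) := by
  intro i j h
  fin_cases i <;> fin_cases j <;> simp [sierpinskiCornerPoint, (Nat.two_pow_pos n).ne] at h ⊢

theorem eq_sierpinskiCornerPoint_of_add_eq_add {n : ℕ} {i j : Fin 3} (hij : i ≠ j) {p q : ℕ × ℕ}
    (hp : p ∈ sierpinskiVertices n) (hq : q ∈ sierpinskiVertices n)
    (h : p + sierpinskiCornerPoint n i = q + sierpinskiCornerPoint n j) :
    p = sierpinskiCornerPoint n j := by
  have hp' := add_le_of_mem_sierpinskiVertices hp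
  have hq' := add_le_of_mem_sierpinskiVertices hq
  rw [Prod.ext_iff] at h ⊢
  fin_cases i <;> fin_cases j <;> simp [sierpinskiCornerPoint] at h hij ⊢ <;> omega

theorem mem_sierpinskiVertices_succ {n : ℕ} {p : ℕ × ℕ} :
    p ∈ sierpinskiVertices (n + 1) ↔
      ∃ i, ∃ q ∈ sierpinskiVertices n, q + sierpinskiCornerPoint n i = p := by
  simp only [sierpinskiVertices, Finset.mem_union, Finset.mem_map, latticeShift,
    addRightEmbedding_apply, sierpinskiCornerPoint, Fin.exists_fin_succ]
  simp [or_assoc, -Prod.exists, Prod.mk_zero_zero]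

theorem sierpinskiLattice_succ_adj {n : ℕ} {p q : ℕ × ℕ} :
    (sierpinskiLattice (n + 1)).Adj p q ↔ ∃ i x y, (sierpinskiLattice n).Adj x y ∧
      x + sierpinskiCornerPoint n i = p ∧ y + sierpinskiCornerPoint n i = q := by
  simp only [sierpinskiLattice, SimpleGraph.sup_adj, SimpleGraph.map_adj, latticeShift,
    addRightEmbedding_apply, sierpinskiCornerPoint, Fin.exists_fin_succ]
  simp [or_assoc, -Prod.exists, Prod.mk_zero_zero]

theorem mem_of_sierpinskiLattice_adj {n : ℕ} {p q : ℕ × ℕ} (h : (sierpinskiLattice n).Adj p q) :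
    p ∈ sierpinskiVertices n := by
  induction n generalizing p q with
  | zero =>
    simp only [sierpinskiLattice, SimpleGraph.fromEdgeSet_adj, Set.mem_insert_iff,
      Set.mem_singleton_iff, Sym2.eq_iff] at h
    simp only [sierpinskiVertices, Finset.mem_insert, Finset.mem_singleton]
    tauto
  | succ n ih =>
    obtain ⟨i, x, y, hadj, rfl, rfl⟩ := sierpinskiLattice_succ_adj.1 h
    exact mem_sierpinskiVertices_succ.2 ⟨i, x, ih hadj, rfl⟩

/-- The copy of `Γ_n` in the corner `i` of `Γ_{n + 1}`. -/
def sierpinskiCopy (n : ℕ) (i : Fin 3) :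
    {p : ℕ × ℕ // p ∈ sierpinskiVertices n} ↪ {p : ℕ × ℕ // p ∈ sierpinskiVertices (n + 1)} where
  toFun p := ⟨p.1 + sierpinskiCornerPoint n i, mem_sierpinskiVertices_succ.2 ⟨i, p.1, p.2, rfl⟩⟩
  inj' _ _ h := Subtype.ext (add_right_cancel (congrArg Subtype.val h))

theorem isCornerGluing_sierpinskiCopy (n : ℕ) :
    IsCornerGluing (sierpinskiCopy n) (sierpinskiCorner n) where
  injective _ _ h := sierpinskiCornerPoint_injective n (congrArg Subtype.val h)
  comm _ _ := Subtype.ext (add_comm _ _)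
  eq_corner {_ _ x y} hij h :=
    have h := congrArg Subtype.val h
    ⟨Subtype.ext (eq_sierpinskiCornerPoint_of_add_eq_add hij x.2 y.2 h),
      Subtype.ext (eq_sierpinskiCornerPoint_of_add_eq_add hij.symm y.2 x.2 h.symm)⟩
  cover v :=
    let ⟨i, q, hq, h⟩ := mem_sierpinskiVertices_succ.1 v.2
    ⟨i, ⟨q, hq⟩, Subtype.ext h⟩

theorem sierpinskiCopy_corner (n : ℕ) :
    (fun i => sierpinskiCopy n i (sierpinskiCorner n i)) = sierpinskiCorner (n + 1) := by
  funext i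
  refine Subtype.ext ?_
  change sierpinskiCornerPoint n i + sierpinskiCornerPoint n i = sierpinskiCornerPoint (n + 1) i
  fin_cases i <;> simp [sierpinskiCornerPoint, pow_succ, mul_two]

theorem glueGraph_sierpinskiGraph (n : ℕ) :
    (glueGraph (sierpinskiCopy n) fun _ => sierpinskiGraph n) = sierpinskiGraph (n + 1) := by
  ext v w
  rw [glueGraph_adj]
  change _ ↔ (sierpinskiLattice (n + 1)).Adj v.1 w.1
  rw [sierpinskiLattice_succ_adj]
  constructor
  · rintro ⟨i, x, y, hadj, rfl, rfl⟩
    exact ⟨i, x.1, y.1, hadj, rfl, rfl⟩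
  · rintro ⟨i, x, y, hadj, hx, hy⟩
    exact ⟨i, ⟨x, mem_of_sierpinskiLattice_adj hadj⟩, ⟨y, mem_of_sierpinskiLattice_adj hadj.symm⟩,
      hadj, Subtype.ext hx, Subtype.ext hy⟩

theorem sierpinskiGraph_zero : sierpinskiGraph 0 = ⊤ := by
  ext ⟨v, hv⟩ ⟨w, hw⟩
  change (sierpinskiLattice 0).Adj v w ↔ _
  simp only [sierpinskiVertices, Finset.mem_insert, Finset.mem_singleton] at hv hw
  rcases hv with rfl | rfl | rfl <;> rcases hw with rfl | rfl | rfl <;>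
    simp [sierpinskiLattice]

theorem sierpinskiCorner_zero_bijective : Function.Bijective (sierpinskiCorner 0) := by
  refine ⟨(isCornerGluing_sierpinskiCopy 0).injective, fun v => ?_⟩
  obtain ⟨v, hv⟩ := v
  have hcases := hv
  simp only [sierpinskiVertices, Finset.mem_insert, Finset.mem_singleton] at hcases
  rcases hcases with rfl | rfl | rfl
  exacts [⟨0, rfl⟩, ⟨1, rfl⟩, ⟨2, rfl⟩]

theorem two_mul_card_sierpinskiVertices (n : ℕ) :
    2 * (sierpinskiVertices n).card = 3 ^ (n + 1) + 3 := by
  induction n with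
  | zero => rfl
  | succ n ih =>
    have hcard := (isCornerGluing_sierpinskiCopy n).card_add_choose
    simp only [Nat.card_eq_fintype_card, Fintype.card_coe, Fintype.card_fin,
      show Nat.choose 3 2 = 3 from rfl] at hcard
    rw [pow_succ]
    omega

end Sierpinski

section ClosedForms

/-- The number `2 ^ a * 3 ^ b * 5 ^ c` with real exponents. -/
noncomputable def rpow235 (a b c : ℝ) : ℝ := (2 : ℝ) ^ a * (3 : ℝ) ^ b * (5 : ℝ) ^ c

theorem rpow235_mul (a b c a' b' c' : ℝ) :
    rpow235 a b c * rpow235 a' b' c' = rpow235 (a + a') (b + b') (c + c') := by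
  simp only [rpow235]
  rw [Real.rpow_add two_pos, Real.rpow_add three_pos, Real.rpow_add (by norm_num : (0 : ℝ) < 5)]
  ring

theorem log_rpow235 (a b c : ℝ) :
    Real.log (rpow235 a b c) = a * Real.log 2 + b * Real.log 3 + c * Real.log 5 := by
  rw [rpow235, Real.log_mul (by positivity) (by positivity),
    Real.log_mul (by positivity) (by positivity), Real.log_rpow two_pos, Real.log_rpow three_pos,
    Real.log_rpow (by norm_num)]

/-- The closed form of the number of spanning forests of `Γ_n` which induce a given partition with
`k` classes on the outmost vertices: it is `τ(Γ_n)`, `s(Γ_n)` and `q(Γ_n)` for `k = 1, 2, 3`. -/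
noncomputable def forestFormula (n : ℕ) : ℕ → ℝ
  | 1 => rpow235 ((3 ^ n - 1) / 2) ((3 ^ (n + 1) + 2 * n + 1) / 4) ((3 ^ n - 2 * n - 1) / 4)
  | 2 => rpow235 ((3 ^ n - 1) / 2) ((3 ^ (n + 1) - 2 * n - 3) / 4) ((3 ^ n + 2 * n - 1) / 4)
  | _ => rpow235 ((3 ^ n - 1) / 2) ((3 ^ (n + 1) - 6 * n - 3) / 4) ((3 ^ n + 6 * n - 1) / 4)

theorem forestFormula_one_mul_three (n : ℕ) :
    forestFormula n 1 * forestFormula n 3 = 3 * forestFormula n 2 ^ 2 := by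
  have h3 : (3 : ℝ) = rpow235 0 1 0 := by simp [rpow235]
  rw [h3]
  simp only [forestFormula, sq, rpow235_mul]
  congr 1 <;> ring

theorem forestFormula_succ_one (n : ℕ) :
    forestFormula (n + 1) 1 = 6 * (forestFormula n 1 ^ 2 * forestFormula n 2) := by
  have h6 : (6 : ℝ) = rpow235 1 1 0 := by norm_num [rpow235]
  rw [h6]
  simp only [forestFormula, sq, rpow235_mul]
  congr 1 <;> push_cast <;> ring

theorem forestFormula_succ_two (n : ℕ) :
    forestFormula (n + 1) 2 =
      forestFormula n 1 ^ 2 * forestFormula n 3 +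
        7 * (forestFormula n 1 * forestFormula n 2 ^ 2) := by
  have h10 : (10 : ℝ) = rpow235 1 0 1 := by norm_num [rpow235]
  have h : forestFormula (n + 1) 2 = 10 * (forestFormula n 1 * forestFormula n 2 ^ 2) := by
    rw [h10]
    simp only [forestFormula, sq, rpow235_mul]
    congr 1 <;> push_cast <;> ring
  rw [h]
  linear_combination -forestFormula n 1 * forestFormula_one_mul_three n

theorem forestFormula_succ_three (n : ℕ) :
    forestFormula (n + 1) 3 =
      12 * (forestFormula n 1 * forestFormula n 2 * forestFormula n 3) +
        14 * forestFormula n 2 ^ 3 := by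
  have h50 : (50 : ℝ) = rpow235 1 0 2 := by norm_num [rpow235]
  have h : forestFormula (n + 1) 3 = 50 * forestFormula n 2 ^ 3 := by
    rw [h50]
    simp only [forestFormula, pow_three, rpow235_mul]
    congr 1 <;> push_cast <;> ring
  rw [h]
  linear_combination -12 * forestFormula n 2 * forestFormula_one_mul_three n

open CornerType

theorem sum_gluings_forestFormula (n : ℕ) (t : CornerType) :
    ∑ u ∈ gluings t, ∏ i, forestFormula n (u i).numClasses =
      forestFormula (n + 1) t.numClasses := by
  cases t with
  | connected => exact (sum_gluings_connected _).trans (forestFormula_succ_one n).symm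
  | isolated k => exact (sum_gluings_isolated _ k).trans (forestFormula_succ_two n).symm
  | separated => exact (sum_gluings_separated _).trans (forestFormula_succ_three n).symm

theorem ncard_terminalForests_sierpinskiGraph (n : ℕ) (t : CornerType) :
    ((terminalForests (sierpinskiCorner n) (sierpinskiGraph n) (equivSetoid t)).ncard : ℝ) =
      forestFormula n t.numClasses := by
  induction n generalizing t with
  | zero =>
    rw [sierpinskiGraph_zero, ncard_terminalForests_of_bijective sierpinskiCorner_zero_bijective]
    cases t <;> norm_num [numClasses, forestFormula, rpow235]
  | succ n ih =>
    rw [← glueGraph_sierpinskiGraph, ← sierpinskiCopy_corner,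
      (isCornerGluing_sierpinskiCopy n).ncard_terminalForests_glueGraph equivSetoid,
      ← sum_gluings_forestFormula]
    push_cast
    simp only [ih, gluings]

theorem numSpanningTrees_sierpinskiGraph (n : ℕ) :
    (numSpanningTrees (sierpinskiGraph n) : ℝ) = forestFormula n 1 := by
  rw [numSpanningTrees_eq_ncard_terminalForests (sierpinskiCorner n), ← equivSetoid_connected,
    ncard_terminalForests_sierpinskiGraph]
  rfl

theorem sierpinskiTwoForests_eq_forestFormula (n : ℕ) {i j k : Fin 3} (hij : i ≠ j) (hik : i ≠ k)
    (hjk : j ≠ k) : (sierpinskiTwoForests n i j k : ℝ) = forestFormula n 2 := by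
  refine Eq.trans ?_ (ncard_terminalForests_sierpinskiGraph n (isolated k))
  refine congrArg (fun s : Set _ => (s.ncard : ℝ)) (Set.ext fun H => ?_)
  rw [mem_terminalForests_equivSetoid_iff, eq_equivSetoid_isolated_iff hij hik hjk]
  rfl

theorem sierpinskiThreeForests_eq_forestFormula (n : ℕ) :
    (sierpinskiThreeForests n : ℝ) = forestFormula n 3 := by
  refine Eq.trans ?_ (ncard_terminalForests_sierpinskiGraph n separated)
  refine congrArg (fun s : Set _ => (s.ncard : ℝ)) (Set.ext fun H => ?_)
  rw [mem_terminalForests_equivSetoid_iff, eq_equivSetoid_separated_iff]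
  rfl

end ClosedForms

section GrowthConstant

theorem tendsto_add_div_pow (a b c : ℝ) {r : ℝ} (hr : 1 < r) :
    Tendsto (fun n : ℕ => (a * r ^ n + b * n + c) / r ^ n) atTop (𝓝 a) := by
  have hlinear : Tendsto (fun n : ℕ => (n : ℝ) / r ^ n) atTop (𝓝 0) := by
    simpa using tendsto_pow_const_div_const_pow_of_one_lt 1 hr
  have hconst : Tendsto (fun n : ℕ => c / r ^ n) atTop (𝓝 0) :=
    tendsto_const_nhds.div_atTop (tendsto_pow_atTop_atTop_of_one_lt hr)
  have hsum := ((hlinear.const_mul b).const_add a).add hconst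
  rw [mul_zero, add_zero, add_zero] at hsum
  refine hsum.congr fun n => ?_
  have : r ^ n ≠ 0 := by positivity
  field_simp

theorem log_numSpanningTrees_sierpinskiGraph (n : ℕ) :
    Real.log (numSpanningTrees (sierpinskiGraph n)) =
      (1 / 2 * Real.log 2 + 3 / 4 * Real.log 3 + 1 / 4 * Real.log 5) * 3 ^ n +
        (Real.log 3 - Real.log 5) / 2 * n +
        (-1 / 2 * Real.log 2 + 1 / 4 * Real.log 3 - 1 / 4 * Real.log 5) := by
  rw [numSpanningTrees_sierpinskiGraph, forestFormula, log_rpow235]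
  ring

theorem card_sierpinskiVertices (n : ℕ) :
    ((sierpinskiVertices n).card : ℝ) = 3 / 2 * 3 ^ n + 0 * n + 3 / 2 := by
  have hcard : (2 * (sierpinskiVertices n).card : ℝ) = 3 ^ (n + 1) + 3 := by
    exact_mod_cast two_mul_card_sierpinskiVertices n
  linear_combination hcard / 2

theorem tendsto_log_numSpanningTrees_div_card :
    Tendsto
      (fun n : ℕ => Real.log (numSpanningTrees (sierpinskiGraph n) : ℝ) /
        ((sierpinskiVertices n).card : ℝ))
      atTop (𝓝 (1 / 3 * Real.log 2 + 1 / 2 * Real.log 3 + 1 / 6 * Real.log 5)) := by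
  simp only [log_numSpanningTrees_sierpinskiGraph, card_sierpinskiVertices]
  have hlim := (tendsto_add_div_pow (1 / 2 * Real.log 2 + 3 / 4 * Real.log 3 + 1 / 4 * Real.log 5)
    ((Real.log 3 - Real.log 5) / 2)
    (-1 / 2 * Real.log 2 + 1 / 4 * Real.log 3 - 1 / 4 * Real.log 5) (r := 3) (by norm_num)).div
    (tendsto_add_div_pow (3 / 2) 0 (3 / 2) (r := 3) (by norm_num)) (by norm_num)
  convert hlim using 2
  · exact (div_div_div_cancel_right₀ (by positivity) _ _).symm
  · ring

end GrowthConstant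

theorem mainTheorem6 :
    (∀ n : ℕ, 1 ≤ n →
      ((numSpanningTrees (sierpinskiGraph n) : ℝ) =
        (2 : ℝ) ^ (((3 : ℝ) ^ n - 1) / 2) *
        (3 : ℝ) ^ (((3 : ℝ) ^ (n + 1) + 2 * (n : ℝ) + 1) / 4) *
        (5 : ℝ) ^ (((3 : ℝ) ^ n - 2 * (n : ℝ) - 1) / 4)) ∧
      (∀ i j k : Fin 3, i ≠ j → i ≠ k → j ≠ k →
        (sierpinskiTwoForests n i j k : ℝ) =
          (2 : ℝ) ^ (((3 : ℝ) ^ n - 1) / 2) *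
          (3 : ℝ) ^ (((3 : ℝ) ^ (n + 1) - 2 * (n : ℝ) - 3) / 4) *
          (5 : ℝ) ^ (((3 : ℝ) ^ n + 2 * (n : ℝ) - 1) / 4)) ∧
      ((sierpinskiThreeForests n : ℝ) =
        (2 : ℝ) ^ (((3 : ℝ) ^ n - 1) / 2) *
        (3 : ℝ) ^ (((3 : ℝ) ^ (n + 1) - 6 * (n : ℝ) - 3) / 4) *
        (5 : ℝ) ^ (((3 : ℝ) ^ n + 6 * (n : ℝ) - 1) / 4))) ∧
    Tendsto
      (fun n : ℕ => Real.log (numSpanningTrees (sierpinskiGraph n) : ℝ) /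
        ((sierpinskiVertices n).card : ℝ))
      atTop (𝓝 (1 / 3 * Real.log 2 + 1 / 2 * Real.log 3 + 1 / 6 * Real.log 5)) := by
  exact ⟨fun n _ => ⟨numSpanningTrees_sierpinskiGraph n,
    fun _ _ _ hij hik hjk => sierpinskiTwoForests_eq_forestFormula n hij hik hjk,
    sierpinskiThreeForests_eq_forestFormula n⟩, tendsto_log_numSpanningTrees_div_card⟩
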